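/- **Proposition.** Let $F$ be a formally real field (i.e. $-1$ is not a sum of squares in $F$) that is not pythagorean (i.e. some sum of squares in $F$ is not a square). A *form* over $F$ is a nondegenerate finite-dimensional quadratic form; it is a *torsion form* if its class in the Witt ring $W F$ has finite additive order. Let $F_{\mathrm{py}}$ and $F_2$ denote the pythagorean closure and the quadratic closure of $F$ in an algebraic closure of $F$, i.e. the smallest intermediate field that is pythagorean, respectively in which every element is a square. For a field extension $K/F$ we say: - $K/F$ is a *2-extension* if $K$ is $F$-isomorphic to a subfield of $F_2$ containing $F$; - $K/F$ is *totally positive* if every ordering of $F$ extends to an ordering of $K$; - $K/F$ is *hereditarily totally positive* if $K/E$ is totally positive for every intermediate field $F\subseteq E\subseteq K$. A form $\varphi$ over $F$ is *2-real-maximal* over a field extension $E$ of $F$ if $E$ is formally real and not pythagorean, $\varphi_E$ is anisotropic, and $\varphi_K$ is isotropic for every nontrivial hereditarily totally positive 2-extension $K/E$. Let $\varphi$ be an anisotropic torsion form over $F$ of dimension at least $1$. Then there exists a field $K$ with $F\subseteq K\subseteq F_{\mathrm{py}}$ such that $K/F$ is a hereditarily totally positive 2-extension and $\varphi$ is 2-real-maximal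 over $K$. -/

import Mathlib

open scoped TensorProduct

universe u v w

noncomputable section

/-! ### Quadratic forms: multiples, Witt equivalence, torsion, scalar extension -/

/-- The hyperbolic plane `⟨1, -1⟩` over `F`. -/
def hyperbolicPlane (F : Type u) [Field F] : QuadraticForm F (F × F) :=
  QuadraticMap.prod (QuadraticMap.sq (R := F)) (-(QuadraticMap.sq (R := F)))

/-- The form `n × φ = φ ⊥ ⋯ ⊥ φ` (`n` summands). -/
def formMultiple {F : Type u} [Field F] {V : Type v} [AddCommGroup V] [Module F V]
    (n : ℕ) (φ : QuadraticForm F V) : QuadraticForm F (Fin n → V) :=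
  QuadraticMap.pi (fun _ : Fin n => φ)

/-- Two forms are Witt equivalent (have the same class in the Witt ring) if they become isometric
after adding hyperbolic planes to both of them. -/
def WittEquivalent {F : Type u} [Field F] {V : Type v} [AddCommGroup V] [Module F V]
    {V' : Type w} [AddCommGroup V'] [Module F V']
    (φ : QuadraticForm F V) (ψ : QuadraticForm F V') : Prop :=
  ∃ a b : ℕ, QuadraticMap.Equivalent
    (QuadraticMap.prod φ (formMultiple a (hyperbolicPlane F)))
    (QuadraticMap.prod ψ (formMultiple b (hyperbolicPlane F)))

/-- `φ` is a torsion form if its Witt class is torsion: for some `n ≥ 1` the class of `n × φ`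
is the class of the zero-dimensional form. -/
def IsTorsionForm {F : Type u} [Field F] {V : Type v} [AddCommGroup V] [Module F V]
    (φ : QuadraticForm F V) : Prop :=
  ∃ n : ℕ, 1 ≤ n ∧ WittEquivalent (formMultiple n φ) (0 : QuadraticForm F PUnit.{1})

/-- The form `φ_K` on `K ⊗[F] V` obtained from `φ` by scalar extension. -/
def formExt {F : Type u} [Field F] [NeZero (2 : F)] {V : Type v} [AddCommGroup V] [Module F V]
    (φ : QuadraticForm F V) (K : Type w) [Field K] [Algebra F K] : QuadraticForm K (K ⊗[F] V) :=
  letI : Invertible (2 : F) := invertibleOfNonzero (NeZero.ne 2)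
  φ.baseChange K

/-! ### Pythagorean fields, pythagorean closure, quadratic closure -/

/-- A field is pythagorean if every sum of squares is a square. -/
def IsPythagorean (F : Type u) [Field F] : Prop :=
  ∀ x : F, IsSumSq x → IsSquare x

/-- The pythagorean closure of `F`: the smallest pythagorean field between `F` and its algebraic
closure. -/
def pythagoreanClosure (F : Type u) [Field F] : IntermediateField F (AlgebraicClosure F) :=
  sInf {L | IsPythagorean L}

/-- The quadratic closure of `F`: the smallest field between `F` and its algebraic closure
in which every element is a square. -/
def quadraticClosure (F : Type u) [Field F] : IntermediateField F (AlgebraicClosure F) :=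
  sInf {L | ∀ x : L, IsSquare x}

/-- `K/F` is a 2-extension if `K` is, up to an isomorphism over `F`, a subfield of the quadratic
closure of `F`. -/
def IsTwoExtension (F : Type u) (K : Type w) [Field F] [Field K] [Algebra F K] : Prop :=
  Nonempty (K →ₐ[F] quadraticClosure F)

/-! ### Totally positive extensions -/

/-- `K/F` is totally positive if every ordering of `F` extends to an ordering of `K`. (An ordering
is given by its cone of nonnegative elements.) -/
def IsTotallyPositive (F : Type u) (K : Type w) [Field F] [Field K] [Algebra F K] : Prop :=
  ∀ P : RingPreordering F, P.IsOrdering →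
    ∃ Q : RingPreordering K, Q.IsOrdering ∧ ∀ x : F, algebraMap F K x ∈ Q ↔ x ∈ P

/-- `K/F` is hereditarily totally positive if `K/E` is totally positive for all intermediate
fields `F ⊆ E ⊆ K`. -/
def IsHereditarilyTotallyPositive (F : Type u) (K : Type w) [Field F] [Field K] [Algebra F K] :
    Prop :=
  ∀ E : IntermediateField F K, IsTotallyPositive E K

/-- The form `φ` over `F` is 2-real-maximal over the extension `E` of `F`: the field `E` is formally
real and not pythagorean, `φ_E` is anisotropic, and `φ_K` is isotropic for every nontrivial
hereditarily totally positive 2-extension `K` of `E`. -/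
structure IsTwoRealMaximal {F : Type u} [Field F] [NeZero (2 : F)] {V : Type v} [AddCommGroup V]
    [Module F V] (φ : QuadraticForm F V) (E : Type u) [Field E] [Algebra F E] : Prop where
  formallyReal : IsSemireal E
  not_pythagorean : ¬ IsPythagorean E
  anisotropic : (formExt φ E).Anisotropic
  isotropic : ∀ (K : Type u) [Field K] [Algebra E K] [Algebra F K] [IsScalarTower F E K],
    ¬ Function.Surjective (algebraMap E K) → IsHereditarilyTotallyPositive E K →
      IsTwoExtension E K → ¬ (formExt φ K).Anisotropic

end

/-! By Zorn, choose `K` maximal among the fields between `F` and its pythagorean closure over which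
`φ` stays anisotropic; chains are harmless because an isotropic vector has finitely many
coordinates. Each required property of `K` has its own reason.

Total positivity: an ordering of any field `E` extends to some pythagorean field inside the
algebraic closure (`exists_isPythagorean_isOrdering`). That field contains the pythagorean closure,
so the ordering restricts to every field in between. In particular `K` is formally real.

Not pythagorean: some multiple of the torsion form `φ` is isotropic, and over a real pythagorean
field the repeated squares combine into single squares, so `φ` itself becomes isotropic
(`IsTorsionForm.not_anisotropic_formExt`).

Maximality: a nontrivial 2-extension `L/K` contains some `s ∉ K` with `s² = a ∈ K`, by Galois theory
of 2-groups (`exists_sqrt_of_isTwoExtension`). Total positivity makes `a` positive at all orderings,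
hence a sum of squares (Artin), so a square root `r` of `a` lies in the pythagorean closure. By
choice of `K`, the form is isotropic over `K(r)`, and `K(r) ≅ K(s) ⊆ L`. -/

/-! ### Preorderings, orderings and Artin's theorem -/

namespace RingPreordering

/-- The preordering `P - aP` obtained by adjoining `-a` for some `a ∉ P`. -/
def adjoinNeg {K : Type*} [Field K] (P : RingPreordering K) {a : K} (ha : a ∉ P) :
    RingPreordering K :=
  mk' {z | ∃ x ∈ P, ∃ y ∈ P, z = x - a * y}
    (by
      rintro _ _ ⟨x, hx, y, hy, rfl⟩ ⟨x', hx', y', hy', rfl⟩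
      exact ⟨x + x', add_mem hx hx', y + y', add_mem hy hy', by ring⟩)
    (by
      rintro _ _ ⟨x, hx, y, hy, rfl⟩ ⟨x', hx', y', hy', rfl⟩
      exact ⟨x * x' + a * a * (y * y'),
        add_mem (mul_mem hx hx') (mul_mem (P.mul_self_mem a) (mul_mem hy hy')),
        x * y' + y * x', add_mem (mul_mem hx hy') (mul_mem hy hx'), by ring⟩)
    (fun x => ⟨x * x, P.mul_self_mem x, 0, zero_mem P, by ring⟩)
    (by
      rintro ⟨x, hx, y, hy, h⟩
      -- If `-1 = x - a y` with `y ≠ 0`, then `a = (1 + x) / y` would already lie in `P`.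
      rcases eq_or_ne y 0 with rfl | hy0
      · exact P.neg_one_notMem (by simpa [h] using hx)
      · refine ha ?_
        have : a = (1 + x) * y⁻¹ := by
          field_simp
          linear_combination h
        rw [this]
        exact mul_mem (add_mem (one_mem P) hx) (inv_mem hy))

theorem le_adjoinNeg {K : Type*} [Field K] (P : RingPreordering K) {a : K} (ha : a ∉ P) :
    P ≤ P.adjoinNeg ha :=
  fun x hx => ⟨x, hx, 0, zero_mem P, by ring⟩

theorem neg_mem_adjoinNeg {K : Type*} [Field K] (P : RingPreordering K) {a : K} (ha : a ∉ P) :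
    -a ∈ P.adjoinNeg ha :=
  ⟨0, zero_mem P, 1, one_mem P, by ring⟩

/-- Every preordering of a field is contained in an ordering. -/
theorem exists_isOrdering_ge {K : Type*} [Field K] (P : RingPreordering K) :
    ∃ Q : RingPreordering K, Q.IsOrdering ∧ P ≤ Q := by
  obtain ⟨Q, hPQ, hQ⟩ := zorn_le_nonempty_Ici₀ P (by
    intro c _ hc R hR
    have key : ∀ {x y : K}, (∃ T ∈ c, x ∈ T) → (∃ T ∈ c, y ∈ T) → ∃ T ∈ c, x ∈ T ∧ y ∈ T := by
      rintro x y ⟨T, hT, hx⟩ ⟨T', hT', hy⟩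
      rcases hc.total hT hT' with h | h
      · exact ⟨T', hT', h hx, hy⟩
      · exact ⟨T, hT, hx, h hy⟩
    refine ⟨mk' {x | ∃ T ∈ c, x ∈ T} ?_ ?_ ?_ ?_, fun T hT x hx => ⟨T, hT, hx⟩⟩
    · intro x y hx hy
      obtain ⟨T, hT, h, h'⟩ := key hx hy
      exact ⟨T, hT, add_mem h h'⟩
    · intro x y hx hy
      obtain ⟨T, hT, h, h'⟩ := key hx hy
      exact ⟨T, hT, mul_mem h h'⟩
    · exact fun x => ⟨R, hR, R.mul_self_mem x⟩
    · rintro ⟨T, -, h⟩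
      exact T.neg_one_notMem h) P le_rfl
  refine ⟨Q, ?_, hPQ⟩
  -- If `a ∉ Q`, then `Q - aQ` is a preordering containing `-a`, and it equals `Q` by maximality.
  have : HasMemOrNegMem Q := ⟨fun a => by
    by_contra! h
    exact h.2 (hQ (Q.le_adjoinNeg h.1) (Q.neg_mem_adjoinNeg h.1))⟩
  refine IsOrdering.mk' Q fun {x y} h => ?_
  simpa using h

/-- The preimage of a preordering under a homomorphism. -/
def comap {K L : Type*} [CommRing K] [CommRing L] (f : K →+* L) (Q : RingPreordering L) :
    RingPreordering K :=
  mk' {x | f x ∈ Q}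
    (fun hx hy => by simpa using add_mem hx hy)
    (fun hx hy => by simpa using mul_mem hx hy)
    (fun x => by simp)
    (fun h => Q.neg_one_notMem (by simpa using h))

theorem mem_comap {K L : Type*} [CommRing K] [CommRing L] {f : K →+* L} {Q : RingPreordering L}
    {x : K} : x ∈ Q.comap f ↔ f x ∈ Q := .rfl

theorem IsOrdering.comap {K L : Type*} [CommRing K] [CommRing L] (f : K →+* L)
    {Q : RingPreordering L} (hQ : Q.IsOrdering) : (Q.comap f).IsOrdering := by
  rw [isOrdering_iff] at hQ ⊢
  intro a b h
  exact hQ (f a) (f b) (by simpa [mem_comap] using h)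

/-- The sums of squares of a semireal field form a preordering. -/
def sumSq (K : Type*) [Field K] [IsSemireal K] : RingPreordering K :=
  mk' {x | IsSumSq x} IsSumSq.add IsSumSq.mul IsSumSq.mul_self
    (IsSemireal.not_isSumSq_neg_one K)

/-- An ordering contained in another one is equal to it. -/
theorem IsOrdering.eq_of_le {K : Type*} [Field K] {P Q : RingPreordering K} (hP : P.IsOrdering)
    (h : P ≤ Q) : Q = P := by
  refine le_antisymm (fun x hx => ?_) h
  rcases mem_or_neg_mem P x with hx' | hx'
  · exact hx'
  · rw [Q.eq_zero_of_mem_of_neg_mem hx (h hx')]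
    exact zero_mem P

end RingPreordering

/-- Artin: a totally positive element of a semireal field is a sum of squares. -/
theorem isSumSq_of_forall_isOrdering {K : Type*} [Field K] [IsSemireal K] {a : K}
    (h : ∀ P : RingPreordering K, P.IsOrdering → a ∈ P) : IsSumSq a := by
  by_contra ha
  obtain ⟨Q, hQ, hle⟩ := ((RingPreordering.sumSq K).adjoinNeg ha).exists_isOrdering_ge
  have := Q.eq_zero_of_mem_of_neg_mem (h Q hQ)
    (hle ((RingPreordering.sumSq K).neg_mem_adjoinNeg ha))
  exact ha (this ▸ IsSumSq.zero)

theorem RingPreordering.isSemireal {K : Type*} [Field K] (P : RingPreordering K) :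
    IsSemireal K :=
  .of_not_isSumSq_neg_one fun h => P.neg_one_notMem (RingPreordering.mem_of_isSumSq h)

theorem exists_isOrdering (K : Type*) [Field K] [IsSemireal K] :
    ∃ P : RingPreordering K, P.IsOrdering :=
  (RingPreordering.sumSq K).exists_isOrdering_ge.imp fun _ h => h.1

/-! ### Adjoining a square root inside a fixed large field -/

namespace IntermediateField

variable {k : Type*} {Ω : Type*} [Field k] [Field Ω] [Algebra k Ω]

/-- The field `M(r) = {x + y r}` obtained by adjoining a square root `r` of an element of `M`. -/
def adjoinSqrt (M : IntermediateField k Ω) (r : Ω) (hr : r * r ∈ M) : IntermediateField k Ω where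
  carrier := {z | ∃ x ∈ M, ∃ y ∈ M, z = x + y * r}
  zero_mem' := ⟨0, zero_mem M, 0, zero_mem M, by ring⟩
  one_mem' := ⟨1, one_mem M, 0, zero_mem M, by ring⟩
  add_mem' := by
    rintro _ _ ⟨x, hx, y, hy, rfl⟩ ⟨x', hx', y', hy', rfl⟩
    exact ⟨x + x', add_mem hx hx', y + y', add_mem hy hy', by ring⟩
  mul_mem' := by
    rintro _ _ ⟨x, hx, y, hy, rfl⟩ ⟨x', hx', y', hy', rfl⟩
    exact ⟨x * x' + y * y' * (r * r), add_mem (mul_mem hx hx') (mul_mem (mul_mem hy hy') hr),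
      x * y' + y * x', add_mem (mul_mem hx hy') (mul_mem hy hx'), by ring⟩
  algebraMap_mem' c := ⟨algebraMap k Ω c, M.algebraMap_mem c, 0, zero_mem M, by ring⟩
  inv_mem' := by
    rintro _ ⟨x, hx, y, hy, rfl⟩
    -- The inverse is conjugate over norm; a vanishing conjugate is treated apart, the element then
    -- being `2x`.
    by_cases h : x - y * r = 0
    · refine ⟨(x + x)⁻¹, inv_mem (add_mem hx hx), 0, zero_mem M, ?_⟩
      rw [← sub_eq_zero.1 h]
      ring
    by_cases h' : x + y * r = 0
    · exact ⟨0, zero_mem M, 0, zero_mem M, by rw [h']; simp⟩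
    have hn : x * x - y * y * (r * r) ∈ M :=
      sub_mem (mul_mem hx hx) (mul_mem (mul_mem hy hy) hr)
    have hne : x * x - y * y * (r * r) ≠ 0 := by
      rw [show x * x - y * y * (r * r) = (x - y * r) * (x + y * r) by ring]
      exact mul_ne_zero h h'
    refine ⟨x * (x * x - y * y * (r * r))⁻¹, mul_mem hx (inv_mem hn),
      -y * (x * x - y * y * (r * r))⁻¹, mul_mem (neg_mem hy) (inv_mem hn),
      inv_eq_of_mul_eq_one_right ?_⟩
    rw [← mul_inv_cancel₀ hne]
    ring

theorem mem_adjoinSqrt {M : IntermediateField k Ω} {r : Ω} {hr : r * r ∈ M} {z : Ω} :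
    z ∈ M.adjoinSqrt r hr ↔ ∃ x ∈ M, ∃ y ∈ M, z = x + y * r := .rfl

theorem le_adjoinSqrt (M : IntermediateField k Ω) (r : Ω) (hr : r * r ∈ M) :
    M ≤ M.adjoinSqrt r hr :=
  fun x hx => ⟨x, hx, 0, zero_mem M, by ring⟩

theorem sqrt_mem_adjoinSqrt (M : IntermediateField k Ω) (r : Ω) (hr : r * r ∈ M) :
    r ∈ M.adjoinSqrt r hr :=
  ⟨0, zero_mem M, 1, one_mem M, by ring⟩

theorem eq_zero_of_add_mul_eq_zero {M : IntermediateField k Ω} {r x y : Ω} (hr : r ∉ M)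
    (hx : x ∈ M) (hy : y ∈ M) (h : x + y * r = 0) : x = 0 ∧ y = 0 := by
  have hy0 : y = 0 := by
    by_contra hy0
    refine hr ?_
    rw [show r = -x * y⁻¹ by field_simp; linear_combination h]
    exact mul_mem (neg_mem hx) (inv_mem hy)
  subst hy0
  simpa using h

theorem exists_mem_of_isChain_sSup {c : Set (IntermediateField k Ω)} (hc : IsChain (· ≤ ·) c)
    (hne : c.Nonempty) {x : Ω} (hx : x ∈ sSup c) : ∃ M ∈ c, x ∈ M := by
  have : Nonempty c := hne.to_subtype
  rw [sSup_eq_iSup', ← SetLike.mem_coe, coe_iSup_of_directed] at hx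
  · simpa using hx
  · exact hc.directedOn.directed_val

end IntermediateField

/-! ### Extending an ordering to a pythagorean field -/

/-- The additive monoid generated by the elements `p x²` with `p ∈ P` and `x ∈ M`. -/
def squareCone {E Ω : Type*} [Field E] [Field Ω] [Algebra E Ω] (P : RingPreordering E)
    (M : IntermediateField E Ω) : AddSubmonoid Ω :=
  AddSubmonoid.closure {c | ∃ p ∈ P, ∃ x ∈ M, c = algebraMap E Ω p * (x * x)}

section squareCone

variable {E Ω : Type*} [Field E] [Field Ω] [Algebra E Ω] {P : RingPreordering E}
  {M : IntermediateField E Ω}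

theorem mem_squareCone_of_mem {p : E} (hp : p ∈ P) {x : Ω} (hx : x ∈ M) :
    algebraMap E Ω p * (x * x) ∈ squareCone P M :=
  AddSubmonoid.subset_closure ⟨p, hp, x, hx, rfl⟩

theorem squareCone_mono {M' : IntermediateField E Ω} (h : M ≤ M') :
    squareCone P M ≤ squareCone P M' :=
  AddSubmonoid.closure_mono fun _ ⟨p, hp, x, hx, hc⟩ => ⟨p, hp, x, h hx, hc⟩

theorem mem_of_mem_squareCone {z : Ω} (hz : z ∈ squareCone P M) : z ∈ M := by
  induction hz using AddSubmonoid.closure_induction with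
  | mem z h =>
    obtain ⟨p, -, x, hx, rfl⟩ := h
    exact mul_mem (M.algebraMap_mem p) (mul_mem hx hx)
  | zero => exact zero_mem M
  | add x y _ _ hx hy => exact add_mem hx hy

theorem mul_mem_squareCone {y z : Ω} (hy : y ∈ squareCone P M) (hz : z ∈ squareCone P M) :
    y * z ∈ squareCone P M := by
  induction hy using AddSubmonoid.closure_induction with
  | mem y h =>
    obtain ⟨p, hp, x, hx, rfl⟩ := h
    induction hz using AddSubmonoid.closure_induction with
    | mem z h =>
      obtain ⟨p', hp', x', hx', rfl⟩ := h
      have := mem_squareCone_of_mem (mul_mem hp hp') (mul_mem hx hx')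
      rwa [map_mul, show algebraMap E Ω p * algebraMap E Ω p' * (x * x' * (x * x')) =
        algebraMap E Ω p * (x * x) * (algebraMap E Ω p' * (x' * x')) by ring] at this
    | zero => simp
    | add z z' _ _ h h' => rw [mul_add]; exact add_mem h h'
  | zero => simp
  | add y y' _ _ h h' => rw [add_mul]; exact add_mem h h'

theorem exists_mem_squareCone_of_isChain {c : Set (IntermediateField E Ω)}
    (hc : IsChain (· ≤ ·) c) (hne : c.Nonempty) {z : Ω} (hz : z ∈ squareCone P (sSup c)) :
    ∃ M ∈ c, z ∈ squareCone P M := by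
  induction hz using AddSubmonoid.closure_induction with
  | mem z h =>
    obtain ⟨p, hp, x, hx, rfl⟩ := h
    obtain ⟨M, hM, hx⟩ := IntermediateField.exists_mem_of_isChain_sSup hc hne hx
    exact ⟨M, hM, mem_squareCone_of_mem hp hx⟩
  | zero => exact hne.imp fun M hM => ⟨hM, zero_mem _⟩
  | add x y _ _ hx hy =>
    obtain ⟨M, hM, hx⟩ := hx
    obtain ⟨M', hM', hy⟩ := hy
    rcases hc.total hM hM' with h | h
    · exact ⟨M', hM', add_mem (squareCone_mono h hx) hy⟩
    · exact ⟨M, hM, add_mem hx (squareCone_mono h hy)⟩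

theorem neg_one_notMem_squareCone_bot : (-1 : Ω) ∉ squareCone P (⊥ : IntermediateField E Ω) := by
  intro h
  have : ∀ z ∈ squareCone P (⊥ : IntermediateField E Ω), ∃ p ∈ P, z = algebraMap E Ω p := by
    intro z hz
    induction hz using AddSubmonoid.closure_induction with
    | mem z h =>
      obtain ⟨p, hp, x, hx, rfl⟩ := h
      obtain ⟨y, rfl⟩ := IntermediateField.mem_bot.1 hx
      exact ⟨p * (y * y), mul_mem hp (P.mul_self_mem y), by simp⟩
    | zero => exact ⟨0, zero_mem P, by simp⟩
    | add x y _ _ hx hy =>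
      obtain ⟨p, hp, rfl⟩ := hx
      obtain ⟨q, hq, rfl⟩ := hy
      exact ⟨p + q, add_mem hp hq, by simp⟩
  obtain ⟨p, hp, hpe⟩ := this _ h
  have : p = -1 := (algebraMap E Ω).injective (by simp [← hpe])
  exact P.neg_one_notMem (this ▸ hp)

theorem mem_squareCone_of_isSumSq {z : M} (hz : IsSumSq z) : (z : Ω) ∈ squareCone P M := by
  induction hz using IsSumSq.rec' with
  | zero => exact zero_mem _
  | sq_add hx _ h =>
    obtain ⟨x, rfl⟩ := hx
    refine add_mem ?_ h
    have := mem_squareCone_of_mem (one_mem P) x.2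
    simpa using this

/-- In `p (x + y r)²` the part free of `r` is `p x² + p y² r²`, which stays in the cone because `r²`
does. Hence adjoining such an `r ∉ M` cannot put `-1` into the cone. -/
theorem mem_squareCone_adjoinSqrt {r : Ω} {hr : r * r ∈ M} (hrP : r * r ∈ squareCone P M) {z : Ω}
    (hz : z ∈ squareCone P (M.adjoinSqrt r hr)) :
    ∃ x ∈ squareCone P M, ∃ y ∈ M, z = x + y * r := by
  induction hz using AddSubmonoid.closure_induction with
  | mem z h =>
    obtain ⟨p, hp, _, ⟨x, hx, y, hy, rfl⟩, rfl⟩ := h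
    refine ⟨algebraMap E Ω p * (x * x) + algebraMap E Ω p * (y * y) * (r * r),
      add_mem (mem_squareCone_of_mem hp hx)
        (mul_mem_squareCone (mem_squareCone_of_mem hp hy) hrP),
      algebraMap E Ω p * (x * y + x * y),
      mul_mem (M.algebraMap_mem p) (add_mem (mul_mem hx hy) (mul_mem hx hy)), by ring⟩
  | zero => exact ⟨0, zero_mem _, 0, zero_mem _, by ring⟩
  | add z z' _ _ hz hz' =>
    obtain ⟨x, hx, y, hy, rfl⟩ := hz
    obtain ⟨x', hx', y', hy', rfl⟩ := hz'
    exact ⟨x + x', add_mem hx hx', y + y', add_mem hy hy', by ring⟩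

/-- Every ordering of `E` extends to a pythagorean field between `E` and a given algebraically
closed extension. -/
theorem exists_isPythagorean_isOrdering [IsAlgClosed Ω] (hP : P.IsOrdering) :
    ∃ M : IntermediateField E Ω, IsPythagorean M ∧
      ∃ Q : RingPreordering M, Q.IsOrdering ∧ ∀ x : E, algebraMap E M x ∈ Q ↔ x ∈ P := by
  -- The condition says that `P` together with the squares of `M` generates a proper preordering of
  -- `M`.
  obtain ⟨M, -, hM⟩ := zorn_le_nonempty₀ {M : IntermediateField E Ω | (-1 : Ω) ∉ squareCone P M}
    (by
      intro c hcS hc R hR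
      refine ⟨sSup c, fun h => ?_, fun M hM => le_sSup hM⟩
      obtain ⟨M, hM, h⟩ := exists_mem_squareCone_of_isChain hc ⟨R, hR⟩ h
      exact hcS hM h) ⊥ neg_one_notMem_squareCone_bot
  refine ⟨M, fun a ha => ?_, ?_⟩
  · obtain ⟨r, hr⟩ := IsAlgClosed.exists_eq_mul_self (a : Ω)
    by_cases hrM : r ∈ M
    · exact ⟨⟨r, hrM⟩, Subtype.ext hr⟩
    exfalso
    have hrr : r * r ∈ M := hr ▸ a.2
    refine hrM (hM.2 ?_ (M.le_adjoinSqrt r hrr) (M.sqrt_mem_adjoinSqrt r hrr))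
    intro h
    obtain ⟨x, hx, y, hy, hxy⟩ :=
      mem_squareCone_adjoinSqrt (hr ▸ mem_squareCone_of_isSumSq ha) h
    have := IntermediateField.eq_zero_of_add_mul_eq_zero hrM
      (add_mem (one_mem M) (mem_of_mem_squareCone hx)) hy (by linear_combination -hxy)
    exact hM.1 (by rwa [show (-1 : Ω) = x by linear_combination -this.1])
  · let Q₀ : RingPreordering M := RingPreordering.mk' {x : M | (x : Ω) ∈ squareCone P M}
      (fun hx hy => (squareCone P M).add_mem hx hy)
      (fun hx hy => mul_mem_squareCone hx hy)
      (fun x => mem_squareCone_of_isSumSq (IsSumSq.mul_self x))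
      hM.1
    obtain ⟨Q, hQ, hle⟩ := Q₀.exists_isOrdering_ge
    refine ⟨Q, hQ, fun x => ?_⟩
    have hPQ : P ≤ Q.comap (algebraMap E M) := fun p hp => hle (by
      have := mem_squareCone_of_mem hp (one_mem M)
      rwa [mul_one, mul_one] at this)
    exact Iff.of_eq (congrArg (x ∈ ·) (hP.eq_of_le hPQ))

end squareCone

/-! ### The pythagorean closure -/

theorem IsSumSq.map_ringHom {K L : Type*} [CommRing K] [CommRing L] (f : K →+* L) {x : K}
    (hx : IsSumSq x) : IsSumSq (f x) := by
  induction hx using IsSumSq.rec' with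
  | zero => simp
  | sq_add hx _ h =>
    rw [map_add]
    exact (hx.map f).isSumSq.add h

/-- Every extension of `F` inside the pythagorean closure is hereditarily totally positive. -/
theorem isHereditarilyTotallyPositive_of_le_pythagoreanClosure {F : Type*} [Field F]
    {K : IntermediateField F (AlgebraicClosure F)} (hK : K ≤ pythagoreanClosure F) :
    IsHereditarilyTotallyPositive F K := by
  intro E P hP
  obtain ⟨M, hM, Q, hQ, hQP⟩ :=
    exists_isPythagorean_isOrdering (Ω := AlgebraicClosure F) hP
  have hle : K ≤ M.restrictScalars F := hK.trans (sInf_le hM)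
  exact ⟨Q.comap (IntermediateField.inclusion hle).toRingHom, hQ.comap _, fun x => hQP x⟩

theorem exists_mem_pythagoreanClosure_of_isSumSq {F : Type*} [Field F]
    {K : IntermediateField F (AlgebraicClosure F)} (hK : K ≤ pythagoreanClosure F) {a : K}
    (ha : IsSumSq a) {r : AlgebraicClosure F} (hr : r * r = a) : r ∈ pythagoreanClosure F := by
  refine IntermediateField.mem_sInf.2 fun L hL => ?_
  have hle : K ≤ L := hK.trans (sInf_le hL)
  obtain ⟨b, hb⟩ := hL _ (ha.map_ringHom (IntermediateField.inclusion hle).toRingHom)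
  have hb : (a : AlgebraicClosure F) = b * b := congrArg Subtype.val hb
  rcases mul_self_eq_mul_self_iff.1 (hr.trans hb) with rfl | rfl
  · exact b.2
  · exact neg_mem b.2

/-! ### The quadratic closure and quadratic subextensions -/

section quadraticClosure

open IntermediateField Polynomial Module

variable {K : Type u} [Field K]

theorem mem_quadraticClosure_of_algEquiv (σ : AlgebraicClosure K ≃ₐ[K] AlgebraicClosure K)
    {x : AlgebraicClosure K} (hx : x ∈ quadraticClosure K) : σ x ∈ quadraticClosure K := by
  refine mem_sInf.2 fun L hL => ?_
  refine mem_sInf.1 hx (L.comap (σ : AlgebraicClosure K →ₐ[K] AlgebraicClosure K)) fun y => ?_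
  obtain ⟨b, hb⟩ := hL ⟨σ y, y.2⟩
  have hb : σ y = b * b := congrArg (Subtype.val (p := (· ∈ L))) hb
  exact ⟨⟨σ.symm b, by change σ (σ.symm b) ∈ L; simp⟩, Subtype.ext (σ.injective (by simp [hb]))⟩

instance normal_quadraticClosure : Normal K (quadraticClosure K) :=
  normal_iff_forall_map_le'.2 fun σ => by
    rintro _ ⟨x, hx, rfl⟩
    exact mem_quadraticClosure_of_algEquiv σ hx

/-- This is the conjugation `r ↦ -r` at the level of polynomial values, without constructing an
automorphism. -/
theorem exists_aeval_add_mul {Ω : Type*} [Field Ω] [Algebra K Ω] (M : IntermediateField K Ω)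
    {x y r : Ω} (hx : x ∈ M) (hy : y ∈ M) (hr : r * r ∈ M) (p : K[X]) :
    ∃ A ∈ M, ∃ B ∈ M, aeval (x + y * r) p = A + B * r ∧ aeval (x - y * r) p = A - B * r := by
  induction p using Polynomial.induction_on with
  | C a => exact ⟨algebraMap K Ω a, M.algebraMap_mem a, 0, zero_mem M, by simp, by simp⟩
  | add p q hp hq =>
    obtain ⟨A, hA, B, hB, h, h'⟩ := hp
    obtain ⟨A', hA', B', hB', h₁, h₁'⟩ := hq
    exact ⟨A + A', add_mem hA hA', B + B', add_mem hB hB', by rw [map_add, h, h₁]; ring,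
      by rw [map_add, h', h₁']; ring⟩
  | monomial n a h =>
    obtain ⟨A, hA, B, hB, h, h'⟩ := h
    refine ⟨A * x + B * y * (r * r), add_mem (mul_mem hA hx) (mul_mem (mul_mem hB hy) hr),
      A * y + B * x, add_mem (mul_mem hA hy) (mul_mem hB hx), ?_, ?_⟩
    · rw [pow_succ, ← mul_assoc, map_mul, h, aeval_X]; ring
    · rw [pow_succ, ← mul_assoc, map_mul, h', aeval_X]; ring

/-- The conjugate over `M` of an element of a normal extension of `K` lies in that extension. -/
theorem sub_mul_sqrt_mem_of_add_mul_sqrt_mem {Ω : Type*} [Field Ω] [Algebra K Ω] [Normal K Ω]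
    (M N : IntermediateField K Ω) [Normal K N]
    {x y r : Ω} (hx : x ∈ M) (hy : y ∈ M) (hr : r * r ∈ M) (hrM : r ∉ M) (h : x + y * r ∈ N) :
    x - y * r ∈ N := by
  have halg : IsAlgebraic K (x + y * r) := Algebra.IsAlgebraic.isAlgebraic _
  obtain ⟨A, hA, B, hB, e, e'⟩ := exists_aeval_add_mul M hx hy hr (minpoly K (x + y * r))
  rw [minpoly.aeval] at e
  obtain ⟨rfl, rfl⟩ := eq_zero_of_add_mul_eq_zero hrM hA hB e.symm
  obtain ⟨σ, hσ⟩ := minpoly.exists_algEquiv_of_root' halg (x := x - y * r) (by rw [e']; ring)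
  rw [← hσ]
  exact normal_iff_forall_map_le'.1 ‹Normal K N› σ ⟨_, h, rfl⟩

/-- A finite normal extension of `K` inside the quadratic closure has no proper subfield over which
its degree is odd. -/
theorem eq_top_of_odd_finrank [CharZero K] (N : IntermediateField K (AlgebraicClosure K))
    [FiniteDimensional K N] [Normal K N] (hN : N ≤ quadraticClosure K)
    (E : IntermediateField K N) (hE : Odd (finrank E N)) : E = ⊤ := by
  obtain ⟨z, hz⟩ := Field.exists_primitive_element K N
  by_contra hne
  have hzE : (z : AlgebraicClosure K) ∉ lift E := by
    rw [mem_lift]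
    intro h
    exact hne (top_le_iff.1 (hz ▸ adjoin_simple_le_iff.2 h))
  -- Take `M ⊇ E` maximal without `z`. It cannot be closed under square roots, and adjoining a
  -- missing one captures `z`, so `z` is quadratic over `M`.
  obtain ⟨M, hEM, hM⟩ := zorn_le_nonempty₀
    {M : IntermediateField K (AlgebraicClosure K) | (z : AlgebraicClosure K) ∉ M}
    (by
      intro c hcS hc R hR
      refine ⟨sSup c, fun h => ?_, fun M hM => le_sSup hM⟩
      obtain ⟨M, hM, h⟩ := IntermediateField.exists_mem_of_isChain_sSup hc ⟨R, hR⟩ h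
      exact hcS hM h) _ hzE
  refine hM.1 ((sInf_le (a := M) ?_ : quadraticClosure K ≤ M) (hN z.2))
  intro a
  obtain ⟨r, hr⟩ := IsAlgClosed.exists_eq_mul_self (a : AlgebraicClosure K)
  by_cases hrM : r ∈ M
  · exact ⟨⟨r, hrM⟩, Subtype.ext hr⟩
  exfalso
  have hrr : r * r ∈ M := hr ▸ a.2
  obtain ⟨x, hx, y, hy, hxy⟩ : (z : AlgebraicClosure K) ∈ M.adjoinSqrt r hrr := by
    by_contra h
    exact hrM (hM.2 h (M.le_adjoinSqrt r hrr) (M.sqrt_mem_adjoinSqrt r hrr))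
  -- By normality, trace and norm of `z` over `M` lie in `M ∩ N`. So `z` has degree at most 2 over
  -- `M ∩ N`, and this degree is odd.
  have hconj : x - y * r ∈ N :=
    sub_mul_sqrt_mem_of_add_mul_sqrt_mem M N hx hy hrr hrM (hxy ▸ z.2)
  let z' : N := ⟨x - y * r, hconj⟩
  let E' : IntermediateField K N := M.comap N.val
  have hEE' : E ≤ E' := fun e he => hEM ((mem_lift e).2 he)
  have htr : z + z' ∈ E' := by
    change (z : AlgebraicClosure K) + (x - y * r) ∈ M
    rw [hxy, show x + y * r + (x - y * r) = x + x by ring]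
    exact add_mem hx hx
  have hnm : z * z' ∈ E' := by
    change (z : AlgebraicClosure K) * (x - y * r) ∈ M
    rw [hxy, show (x + y * r) * (x - y * r) = x * x - y * y * (r * r) by ring]
    exact sub_mem (mul_mem hx hx) (mul_mem (mul_mem hy hy) hrr)
  have htop : E'⟮z⟯ = ⊤ := by
    refine eq_top_iff.2 fun w _ => ?_
    have : K⟮z⟯ ≤ E'⟮z⟯.restrictScalars K :=
      adjoin_simple_le_iff.2 (mem_adjoin_simple_self E' z)
    exact this (hz ▸ mem_top)
  have hdeg := (Field.primitive_element_iff_minpoly_natDegree_eq E' z).1 htop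
  have hle : (minpoly E' z).natDegree ≤ 2 := by
    let p : E'[X] := X ^ 2 - C ⟨z + z', htr⟩ * X + C ⟨z * z', hnm⟩
    have hp : p.Monic := by unfold p; monicity!
    have hp2 : p.natDegree = 2 := by unfold p; compute_degree!
    rw [← hp2]
    refine natDegree_le_natDegree (minpoly.min E' z hp ?_)
    simp only [p, aeval_def, eval₂_add, eval₂_sub, eval₂_mul, eval₂_pow, eval₂_X, eval₂_C]
    change z ^ 2 - (z + z') * z + z * z' = 0
    ring
  have hodd : Odd (finrank E' N) := hE.of_dvd_nat (finrank_dvd_of_le_left hEE')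
  rw [hdeg] at hle
  have h1 : finrank E' N = 1 := by
    obtain ⟨m, hm⟩ := hodd
    omega
  have : E' = ⊤ := finrank_eq_one_iff_eq_top.1 h1
  exact hM.1 (show z ∈ E' from this ▸ mem_top)

/-- For an odd prime divisor of the group order, Cauchy gives a cyclic subgroup whose fixed field
contradicts `eq_top_of_odd_finrank`. -/
theorem exists_card_eq_two_pow [CharZero K] (N : IntermediateField K (AlgebraicClosure K))
    [FiniteDimensional K N] [Normal K N] (hN : N ≤ quadraticClosure K) :
    ∃ n, Nat.card Gal(N/K) = 2 ^ n := by
  refine ⟨_, Nat.eq_prime_pow_of_unique_prime_dvd Nat.card_pos.ne' fun {ℓ} hℓ hdvd => ?_⟩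
  by_contra h2
  have : Fact ℓ.Prime := ⟨hℓ⟩
  obtain ⟨g, hg⟩ := exists_prime_orderOf_dvd_card' ℓ hdvd
  have hcard : finrank (fixedField (Subgroup.zpowers g)) N = ℓ := by
    rw [finrank_fixedField_eq_card, Nat.card_zpowers, hg]
  have htop := eq_top_of_odd_finrank N hN (fixedField (Subgroup.zpowers g))
    (hcard ▸ hℓ.odd_of_ne_two h2)
  exact hℓ.one_lt.ne' (hcard.symm.trans (finrank_eq_one_iff_eq_top.2 htop))

/-- An extension of degree two in characteristic zero is generated by a square root. -/
theorem exists_sqrt_of_finrank_eq_two [CharZero K] {N : Type*} [Field N] [Algebra K N]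
    (D : IntermediateField K N) (hD : finrank K D = 2) :
    ∃ s ∈ D, s ∉ (⊥ : IntermediateField K N) ∧ ∃ a : K, s * s = algebraMap K N a := by
  have : FiniteDimensional K D := FiniteDimensional.of_finrank_pos (by omega)
  obtain ⟨d, hdD, hd⟩ : ∃ d ∈ D, d ∉ (⊥ : IntermediateField K N) := by
    by_contra! h
    rw [le_bot_iff.1 (show D ≤ ⊥ from h), IntermediateField.finrank_bot] at hD
    omega
  have hint : IsIntegral K (⟨d, hdD⟩ : D) := IsIntegral.of_finite K _
  have hle : (minpoly K (⟨d, hdD⟩ : D)).natDegree ≤ 2 := hD ▸ minpoly.natDegree_le _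
  have hge : 2 ≤ (minpoly K (⟨d, hdD⟩ : D)).natDegree := by
    rw [minpoly.two_le_natDegree_iff hint]
    rintro ⟨c, hc⟩
    exact hd (mem_bot.2 ⟨c, congrArg Subtype.val hc⟩)
  have hdeg := le_antisymm hle hge
  have hmon : (minpoly K (⟨d, hdD⟩ : D)).coeff 2 = 1 := hdeg ▸ (minpoly.monic hint)
  have hroot : d ^ 2 + algebraMap K N ((minpoly K (⟨d, hdD⟩ : D)).coeff 1) * d +
      algebraMap K N ((minpoly K (⟨d, hdD⟩ : D)).coeff 0) = 0 := by
    have h := minpoly.aeval K (⟨d, hdD⟩ : D)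
    rw [aeval_eq_sum_range, hdeg, Finset.sum_range_succ, Finset.sum_range_succ,
      Finset.sum_range_one, hmon] at h
    have h := congrArg (algebraMap D N) h
    simp only [Algebra.smul_def, map_add, map_mul, map_pow, map_one, map_zero, pow_zero, pow_one,
      one_mul, mul_one, ← IsScalarTower.algebraMap_apply K D N] at h
    have e : algebraMap D N ⟨d, hdD⟩ = d := rfl
    rw [e] at h
    linear_combination h
  generalize (minpoly K (⟨d, hdD⟩ : D)).coeff 1 = b at hroot
  generalize (minpoly K (⟨d, hdD⟩ : D)).coeff 0 = c at hroot
  have h2 : algebraMap K N (b / 2) * 2 = algebraMap K N b := by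
    rw [← map_ofNat (algebraMap K N) 2, ← map_mul]
    congr 1
    field_simp
  refine ⟨d + algebraMap K N (b / 2), add_mem hdD (D.algebraMap_mem _), fun h => hd ?_,
    b / 2 * (b / 2) - c, ?_⟩
  · simpa using sub_mem h (IntermediateField.algebraMap_mem ⊥ (b / 2))
  · rw [map_sub, map_mul]
    linear_combination hroot + h2 * d

/-- A nontrivial 2-extension contains a quadratic extension. -/
theorem exists_sqrt_of_isTwoExtension [CharZero K] {L : Type w} [Field L] [Algebra K L]
    (h2 : IsTwoExtension K L) (hne : ¬ Function.Surjective (algebraMap K L)) :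
    ∃ (a : K) (s : L), s * s = algebraMap K L a ∧ s ∉ Set.range (algebraMap K L) := by
  obtain ⟨f⟩ := h2
  simp only [Function.Surjective, not_forall] at hne
  obtain ⟨x, hx⟩ := hne
  let ξ : AlgebraicClosure K := f x
  have hξbot : ξ ∉ (⊥ : IntermediateField K (AlgebraicClosure K)) := by
    rintro ⟨c, hc⟩
    exact hx ⟨c, f.injective (Subtype.ext (by simpa using hc))⟩
  have : FiniteDimensional K K⟮ξ⟯ := adjoin.finiteDimensional (Algebra.IsIntegral.isIntegral ξ)
  let N := normalClosure K K⟮ξ⟯ (AlgebraicClosure K)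
  have hN : N ≤ quadraticClosure K :=
    normalClosure_le_iff_of_normal.2 (adjoin_simple_le_iff.2 (f x).2)
  have hξN : ξ ∈ N := le_normalClosure _ (mem_adjoin_simple_self K ξ)
  let η : N := ⟨ξ, hξN⟩
  obtain ⟨n, hn⟩ := exists_card_eq_two_pow N hN
  let H := fixingSubgroup K⟮η⟯
  have hfix : fixedField H = K⟮η⟯ := IsGalois.fixedField_fixingSubgroup _
  obtain ⟨j, hj, hHj⟩ := (Nat.dvd_prime_pow Nat.prime_two).1 (hn ▸ H.card_subgroup_dvd_card)
  have hjn : j < n := by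
    refine lt_of_le_of_ne hj fun h => hξbot ?_
    have htop : H = ⊤ := H.eq_top_of_card_eq (by rw [hHj, hn, h])
    have hη : η ∈ fixedField H := hfix ▸ mem_adjoin_simple_self K η
    rw [htop, IsGalois.fixedField_top] at hη
    obtain ⟨c, hc⟩ := hη
    exact ⟨c, congrArg Subtype.val hc⟩
  -- A proper subgroup of a 2-group lies in one of index 2, whose fixed field is a quadratic
  -- extension inside `K⟮η⟯`.
  obtain ⟨H', hH', hle⟩ := Sylow.exists_subgroup_card_pow_prime_le (G := Gal(N/K)) 2
    (m := n - 1) (hn ▸ pow_dvd_pow 2 (Nat.sub_le n 1)) H hHj (by omega)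
  have hD : finrank K (fixedField H') = 2 := by
    have h1 := finrank_fixedField_eq_card H'
    have h3 := finrank_mul_finrank K (fixedField H') N
    rw [h1, hH', ← IsGalois.card_aut_eq_finrank K N, hn] at h3
    have : 2 ^ n = 2 * 2 ^ (n - 1) := by
      rw [← pow_succ']
      congr 1
      omega
    rw [this] at h3
    exact Nat.eq_of_mul_eq_mul_right (by positivity) h3
  obtain ⟨s, hs, hsbot, a, ha⟩ := exists_sqrt_of_finrank_eq_two (fixedField H') hD
  have hsη : s ∈ K⟮η⟯ := by
    rw [← hfix]
    exact fun g => hs ⟨g, hle g.2⟩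
  have hle' : K⟮η⟯ ≤ (((quadraticClosure K).val.comp f).fieldRange).comap N.val :=
    adjoin_simple_le_iff.2 ⟨x, rfl⟩
  obtain ⟨t, ht⟩ := hle' hsη
  have ht : ((f t : quadraticClosure K) : AlgebraicClosure K) = s := ht
  refine ⟨a, t, f.injective (Subtype.ext ?_), ?_⟩
  · have := congrArg (Subtype.val (p := (· ∈ N))) ha
    simpa [ht] using this
  · rintro ⟨c, rfl⟩
    refine hsbot ⟨c, Subtype.ext ?_⟩
    simpa using ht

end quadraticClosure

/-! ### Torsion forms and isotropy -/

open Module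

theorem finrank_le_of_dotProduct_eq_zero {F : Type*} [Field F] {n : ℕ}
    (R T : Submodule F (Fin n → F)) (h : ∀ r ∈ R, ∀ t ∈ T, t ⬝ᵥ r = 0) :
    finrank F R + finrank F T ≤ n := by
  have hT : T.map (dotProductEquiv F (Fin n)).toLinearMap ≤ R.dualAnnihilator := by
    rintro _ ⟨t, ht, rfl⟩
    rw [Submodule.mem_dualAnnihilator]
    exact fun r hr => h r hr t ht
  have h1 := Submodule.finrank_mono hT
  rw [LinearEquiv.finrank_map_eq] at h1
  have h2 := Subspace.finrank_add_finrank_dualAnnihilator_eq R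
  rw [finrank_fin_fun] at h2
  omega

theorem formMultiple_hyperbolicPlane_apply {F : Type u} [Field F] (n : ℕ) (x : Fin n → F × F) :
    formMultiple n (hyperbolicPlane F) x = ∑ i, ((x i).1 * (x i).1 - (x i).2 * (x i).2) := by
  simp [formMultiple, hyperbolicPlane, QuadraticMap.pi_apply, sub_eq_add_neg]

/-- The orthogonal sum of an anisotropic form and `a` hyperbolic planes has no totally isotropic
subspace of dimension greater than `a`. -/
theorem finrank_le_of_totallyIsotropic {F : Type u} [Field F] [NeZero (2 : F)] {V : Type v}
    [AddCommGroup V] [Module F V] [FiniteDimensional F V] {q : QuadraticForm F V}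
    (hq : q.Anisotropic) (a : ℕ) (W : Submodule F (V × (Fin a → F × F)))
    (hW : ∀ x ∈ W, q.prod (formMultiple a (hyperbolicPlane F)) x = 0) : finrank F W ≤ a := by
  -- Each plane is `u² - v² = (u - v)(u + v)`; `f` records `u - v` and `g` records `u`. On `W ∩ ker
  -- f` the map `g` is injective, with image orthogonal to `f(W)`, so the two dimensions add up to
  -- at most `a`.
  let f : V × (Fin a → F × F) →ₗ[F] (Fin a → F) :=
    LinearMap.pi fun i => (LinearMap.fst F F F - LinearMap.snd F F F) ∘ₗ LinearMap.proj i ∘ₗ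
      LinearMap.snd F V _
  let g : V × (Fin a → F × F) →ₗ[F] (Fin a → F) :=
    LinearMap.pi fun i => LinearMap.fst F F F ∘ₗ LinearMap.proj i ∘ₗ LinearMap.snd F V _
  have hf : ∀ x i, f x i = (x.2 i).1 - (x.2 i).2 := fun x i => rfl
  have hg : ∀ x i, g x i = (x.2 i).1 := fun x i => rfl
  have hker : ∀ x ∈ W, f x = 0 → x.1 = 0 := by
    intro x hx hfx
    refine hq _ ?_
    have h := hW x hx
    rw [QuadraticMap.prod_apply, formMultiple_hyperbolicPlane_apply, Finset.sum_eq_zero,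
      add_zero] at h
    · exact h
    · intro i _
      have := hf x i
      rw [hfx, Pi.zero_apply] at this
      linear_combination -((x.2 i).1 + (x.2 i).2) * this
  have horth : ∀ x ∈ W, ∀ t ∈ W, f t = 0 → g t ⬝ᵥ f x = 0 := by
    intro x hx t ht hft
    have h0 := hker t ht hft
    have h1 := hW _ (add_mem hx ht)
    have h2 := hW _ hx
    rw [QuadraticMap.prod_apply, formMultiple_hyperbolicPlane_apply] at h1 h2
    rw [Prod.fst_add, h0, add_zero] at h1
    have h3 : ∑ i, (((x + t).2 i).1 * ((x + t).2 i).1 - ((x + t).2 i).2 * ((x + t).2 i).2) -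
        ∑ i, ((x.2 i).1 * (x.2 i).1 - (x.2 i).2 * (x.2 i).2) = 0 := by
      linear_combination h1 - h2
    rw [← Finset.sum_sub_distrib] at h3
    have h4 : 2 * (g t ⬝ᵥ f x) = 0 := by
      rw [← h3, dotProduct, Finset.mul_sum]
      refine Finset.sum_congr rfl fun i _ => ?_
      have := hf t i
      rw [hft, Pi.zero_apply] at this
      rw [hf, hg]
      simp only [Prod.snd_add, Prod.fst_add, Pi.add_apply]
      rw [show (t.2 i).2 = (t.2 i).1 by linear_combination this]
      ring
    exact (mul_eq_zero.1 h4).resolve_left (NeZero.ne 2)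
  let f' := f ∘ₗ W.subtype
  let g' := g ∘ₗ W.subtype
  have hinj : Function.Injective (g' ∘ₗ (LinearMap.ker f').subtype) := by
    refine (injective_iff_map_eq_zero _).2 ?_
    rintro ⟨⟨t, ht⟩, hft⟩ hgt
    have hft : f t = 0 := hft
    have hgt : g t = 0 := hgt
    ext1; ext1
    refine Prod.ext (hker t ht hft) (funext fun i => Prod.ext ?_ ?_)
    · exact (hg t i).symm.trans (congrFun hgt i)
    · have h1 := hf t i
      have h2 := hg t i
      rw [hft, Pi.zero_apply] at h1
      rw [hgt, Pi.zero_apply] at h2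
      change (t.2 i).2 = 0
      linear_combination h1 - h2
  have h1 := finrank_le_of_dotProduct_eq_zero (LinearMap.range f')
    (LinearMap.range (g' ∘ₗ (LinearMap.ker f').subtype)) (by
      rintro _ ⟨x, rfl⟩ _ ⟨t, rfl⟩
      exact horth x x.2 t.1 t.1.2 t.2)
  rw [LinearMap.finrank_range_of_inj hinj] at h1
  exact (f'.finrank_range_add_finrank_ker).symm.le.trans h1

/-- Some multiple of a nonzero torsion form is isotropic. -/
theorem IsTorsionForm.exists_not_anisotropic {F : Type u} [Field F] [NeZero (2 : F)] {V : Type v}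
    [AddCommGroup V] [Module F V] [FiniteDimensional F V] [Nontrivial V] {φ : QuadraticForm F V}
    (h : IsTorsionForm φ) : ∃ n : ℕ, ¬ (formMultiple n φ).Anisotropic := by
  obtain ⟨n, hn, a, b, ⟨e⟩⟩ := h
  refine ⟨n, fun han => ?_⟩
  have hdim := e.toLinearEquiv.finrank_eq
  simp only [Module.finrank_prod, Module.finrank_pi_fintype, Finset.sum_const, Finset.card_univ,
    Fintype.card_fin, smul_eq_mul, Module.finrank_self, finrank_zero_of_subsingleton] at hdim
  have hV : 0 < n * finrank F V := Nat.mul_pos hn finrank_pos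
  -- The diagonals of the `b` planes span a totally isotropic subspace, forcing `b ≤ a`; but `n dim
  -- V + 2a = 2b` with `n dim V > 0`.
  let d : (Fin b → F) →ₗ[F] PUnit.{1} × (Fin b → F × F) :=
    LinearMap.prod 0 (LinearMap.pi fun i => LinearMap.prod (LinearMap.proj i) (LinearMap.proj i))
  have hd : ∀ x i, (d x).2 i = (x i, x i) := fun _ _ => rfl
  have hdinj : Function.Injective d := by
    intro x y hxy
    funext i
    have := congrArg (fun z => (z.2 i).1) hxy
    simpa [hd] using this
  have hW := finrank_le_of_totallyIsotropic han a (LinearMap.range (e.symm.toLinearMap ∘ₗ d)) (by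
    rintro _ ⟨x, rfl⟩
    refine (e.symm.map_app (d x)).trans ?_
    rw [QuadraticMap.prod_apply, formMultiple_hyperbolicPlane_apply]
    simp [hd])
  rw [LinearMap.finrank_range_of_inj (by exact e.symm.toLinearEquiv.injective.comp hdinj),
    finrank_fin_fun] at hW
  omega

/-- The values of a scalar extension in coordinates with respect to an orthogonal basis. -/
theorem formExt_anisotropic_iff {F : Type u} [Field F] [NeZero (2 : F)] {V : Type v}
    [AddCommGroup V] [Module F V] {ι : Type*} [Fintype ι] (b : Basis ι F V)
    (φ : QuadraticForm F V) (hb : (QuadraticMap.polarBilin φ).IsOrthoᵢ b)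
    (K : Type w) [Field K] [Algebra F K] :
    (formExt φ K).Anisotropic ↔
      ∀ x : ι → K, ∑ i, algebraMap F K (φ (b i)) * (x i * x i) = 0 → x = 0 := by
  let : Invertible (2 : F) := invertibleOfNonzero (NeZero.ne 2)
  have h2 : (2 : K) ≠ 0 := by
    rw [← map_ofNat (algebraMap F K) 2]
    exact (map_ne_zero (algebraMap F K)).2 (NeZero.ne (2 : F))
  have : Invertible (2 : K) := invertibleOfNonzero h2
  have hext : formExt φ K = φ.baseChange K := rfl
  let B := b.baseChange K
  have hB : (QuadraticMap.associated (R := K) (formExt φ K)).IsOrthoᵢ B := by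
    intro i j hij
    change QuadraticMap.associated (formExt φ K) (B i) (B j) = 0
    rw [QuadraticMap.associated_isOrtho, ← QuadraticMap.isOrtho_polarBilin, hext,
      QuadraticForm.polarBilin_baseChange, Basis.baseChange_apply, Basis.baseChange_apply,
      LinearMap.BilinForm.baseChange_tmul, show φ.polarBilin (b i) (b j) = 0 from hb hij, zero_smul]
  have hval : ∀ x : ι → K,
      formExt φ K (∑ i, x i • B i) = ∑ i, algebraMap F K (φ (b i)) * (x i * x i) := by
    intro x
    rw [← QuadraticMap.basisRepr_apply, QuadraticMap.basisRepr_eq_of_iIsOrtho _ _ hB,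
      QuadraticMap.weightedSumSquares_apply]
    refine Finset.sum_congr rfl fun i _ => ?_
    rw [hext, Basis.baseChange_apply, QuadraticForm.baseChange_tmul, mul_one, smul_eq_mul,
      Algebra.smul_def, mul_one]
  constructor
  · intro h x hx
    have := h _ ((hval x).trans hx)
    funext i
    exact Fintype.linearIndependent_iff.1 B.linearIndependent x this i
  · intro h v hv
    rw [← B.sum_repr v, hval] at hv
    have := h _ hv
    exact B.repr.map_eq_zero_iff.1 (DFunLike.coe_injective this)

theorem QuadraticMap.apply_sum_smul_of_isOrthoᵢ {F : Type u} [Field F] [NeZero (2 : F)]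
    {V : Type v} [AddCommGroup V] [Module F V] {ι : Type*} [Fintype ι] (b : Basis ι F V)
    (φ : QuadraticForm F V) (hb : (QuadraticMap.polarBilin φ).IsOrthoᵢ b) (x : ι → F) :
    φ (∑ i, x i • b i) = ∑ i, φ (b i) * (x i * x i) := by
  have : Invertible (2 : F) := invertibleOfNonzero (NeZero.ne 2)
  have hb' : (QuadraticMap.associated (R := F) φ).IsOrthoᵢ b := by
    intro i j hij
    change QuadraticMap.associated φ (b i) (b j) = 0
    rw [QuadraticMap.associated_isOrtho, ← QuadraticMap.isOrtho_polarBilin]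
    exact hb hij
  rw [← QuadraticMap.basisRepr_apply, QuadraticMap.basisRepr_eq_of_iIsOrtho _ _ hb',
    QuadraticMap.weightedSumSquares_apply]
  rfl

theorem QuadraticForm.exists_basis_isOrthoᵢ {F : Type u} [Field F] [NeZero (2 : F)] {V : Type v}
    [AddCommGroup V] [Module F V] [FiniteDimensional F V] (φ : QuadraticForm F V) :
    ∃ b : Basis (Fin (finrank F V)) F V, (QuadraticMap.polarBilin φ).IsOrthoᵢ b := by
  have : Invertible (2 : F) := invertibleOfNonzero (NeZero.ne 2)
  exact LinearMap.BilinForm.exists_orthogonal_basis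
    ⟨fun x y => QuadraticMap.polar_comm φ x y⟩

theorem isSumSq_sum_mul_self {K : Type*} [Field K] {n : ℕ} (x : Fin n → K) :
    IsSumSq (∑ i, x i * x i) :=
  IsSumSq.sum fun _ _ => IsSumSq.mul_self _

/-- In a semireal field a sum of squares vanishes only if each square does. -/
theorem eq_zero_of_sum_mul_self_eq_zero {K : Type*} [Field K] [IsSemireal K] {n : ℕ}
    {x : Fin n → K} (h : ∑ i, x i * x i = 0) (i : Fin n) : x i = 0 := by
  have h1 := Finset.add_sum_erase Finset.univ (fun i => x i * x i) (Finset.mem_univ i)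
  rw [h] at h1
  have h2 : IsSumSq (∑ j ∈ Finset.univ.erase i, x j * x j) :=
    IsSumSq.sum fun _ _ => IsSumSq.mul_self _
  have h3 : -(x i * x i) ∈ RingPreordering.sumSq K := by
    rw [← eq_neg_of_add_eq_zero_right h1]
    exact h2
  exact mul_self_eq_zero.1 (RingPreordering.eq_zero_of_mem_of_neg_mem
    ((RingPreordering.sumSq K).mul_self_mem _) h3)

/-- A nonzero torsion form is isotropic over every pythagorean semireal extension. -/
theorem IsTorsionForm.not_anisotropic_formExt {F : Type u} [Field F] [NeZero (2 : F)] {V : Type v}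
    [AddCommGroup V] [Module F V] [FiniteDimensional F V] [Nontrivial V] {φ : QuadraticForm F V}
    (h : IsTorsionForm φ) (K : Type w) [Field K] [Algebra F K] [IsSemireal K]
    (hK : IsPythagorean K) : ¬ (formExt φ K).Anisotropic := by
  intro han
  obtain ⟨b, hb⟩ := φ.exists_basis_isOrthoᵢ
  obtain ⟨n, hn⟩ := h.exists_not_anisotropic
  rw [formExt_anisotropic_iff b φ hb] at han
  refine hn fun v hv => funext fun j => ?_
  -- For each basis index, the squares coming from the `n` copies of `φ` merge into the single
  -- square `y i * y i`.
  choose y hy using fun i => hK _ (isSumSq_sum_mul_self fun j => algebraMap F K (b.repr (v j) i))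
  have hy0 : y = 0 := by
    refine han y ?_
    have h1 : ∑ j, ∑ i, φ (b i) * (b.repr (v j) i * b.repr (v j) i) = 0 := by
      rw [← hv, formMultiple, QuadraticMap.pi_apply]
      refine Finset.sum_congr rfl fun j _ => ?_
      rw [← QuadraticMap.apply_sum_smul_of_isOrthoᵢ b φ hb, b.sum_repr]
    rw [Finset.sum_comm] at h1
    have h2 := congrArg (algebraMap F K) h1
    rw [map_zero, map_sum] at h2
    rw [← h2]
    refine Finset.sum_congr rfl fun i _ => ?_
    rw [← hy, ← Finset.mul_sum, map_mul, map_sum]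
    simp only [map_mul]
  refine b.ext_elem fun i => ?_
  have h3 := hy i
  rw [hy0, Pi.zero_apply, mul_zero] at h3
  have := eq_zero_of_sum_mul_self_eq_zero h3 j
  simpa using this

/-! ### Square roots in totally positive extensions and the maximal field -/

/-- A diagonal form evaluated at `X + Y r`, where `r` is a square root of `a`. -/
theorem map_sum_add_map_sum_mul_sqrt {K L : Type*} [CommRing K] [CommRing L] (f : K →+* L)
    {n : ℕ} (c X Y : Fin n → K) {a : K} {r : L} (hr : r * r = f a) :
    f (∑ i, c i * (X i * X i + a * (Y i * Y i))) + f (∑ i, c i * (2 * (X i * Y i))) * r =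
      ∑ i, f (c i) * ((f (X i) + f (Y i) * r) * (f (X i) + f (Y i) * r)) := by
  rw [map_sum, map_sum, Finset.sum_mul, ← Finset.sum_add_distrib]
  refine Finset.sum_congr rfl fun i _ => ?_
  simp only [map_mul, map_add, map_ofNat, ← hr]
  ring

/-- A square root of an element of `K` in a hereditarily totally positive extension of `K` is the
square root of a sum of squares. -/
theorem IsHereditarilyTotallyPositive.isSumSq {K : Type u} {L : Type w} [Field K] [IsSemireal K]
    [Field L] [Algebra K L] (h : IsHereditarilyTotallyPositive K L) {a : K} {s : L}
    (hs : s * s = algebraMap K L a) : IsSumSq a := by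
  refine isSumSq_of_forall_isOrdering fun P hP => ?_
  let e : (⊥ : IntermediateField K L) ≃ₐ[K] K := IntermediateField.botEquiv K L
  obtain ⟨Q, hQ, hQP⟩ := h ⊥ (P.comap (e : _ →+* K)) (hP.comap _)
  have h1 := (hQP (algebraMap K _ a)).1 (by
    rw [← IsScalarTower.algebraMap_apply, ← hs]
    exact Q.mul_self_mem s)
  have h2 : e (algebraMap K _ a) ∈ P := h1
  rwa [e.commutes] at h2

theorem mainTheorem11 {F : Type u} [Field F] [IsSemireal F] (hF : ¬ IsPythagorean F)
    {V : Type v} [AddCommGroup V] [Module F V] [FiniteDimensional F V] [Nontrivial V]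
    (φ : QuadraticForm F V) (hnd : φ.Nondegenerate) (han : φ.Anisotropic)
    (htor : IsTorsionForm φ) :
    ∃ K : IntermediateField F (AlgebraicClosure F),
      K ≤ pythagoreanClosure F ∧
      IsHereditarilyTotallyPositive F K ∧
      IsTwoExtension F K ∧
      IsTwoRealMaximal φ K := by
  obtain ⟨b, hb⟩ := φ.exists_basis_isOrthoᵢ
  let Ω := AlgebraicClosure F
  let q : (Fin (finrank F V) → Ω) → Ω := fun x => ∑ i, algebraMap F Ω (φ (b i)) * (x i * x i)
  have hiff : ∀ K : IntermediateField F Ω, (formExt φ K).Anisotropic ↔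
      ∀ x, (∀ i, x i ∈ K) → q x = 0 → x = 0 := by
    intro K
    rw [formExt_anisotropic_iff b φ hb]
    constructor
    · intro h x hx hqx
      have := h (fun i => ⟨x i, hx i⟩) (Subtype.ext (by simpa [q] using hqx))
      funext i
      exact congrArg Subtype.val (congrFun this i)
    · intro h x hx
      have := h (fun i => x i) (fun i => (x i).2) (by
        have := congrArg (algebraMap K Ω) hx
        simpa [q] using this)
      funext i
      exact Subtype.ext (congrFun this i)
  have hbot : (formExt φ (⊥ : IntermediateField F Ω)).Anisotropic := by
    rw [formExt_anisotropic_iff b φ hb]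
    intro x hx
    let e := IntermediateField.botEquiv F Ω
    have h1 := han (∑ i, e (x i) • b i) (by
      rw [QuadraticMap.apply_sum_smul_of_isOrthoᵢ b φ hb]
      have := congrArg e hx
      rw [map_sum, map_zero] at this
      rw [← this]
      refine Finset.sum_congr rfl fun i _ => ?_
      rw [map_mul, map_mul, e.commutes]
      rfl)
    funext i
    exact e.map_eq_zero_iff.1 (Fintype.linearIndependent_iff.1 b.linearIndependent _ h1 i)
  obtain ⟨K, -, hK⟩ := zorn_le_nonempty₀
    {K : IntermediateField F Ω | K ≤ pythagoreanClosure F ∧ ∀ x, (∀ i, x i ∈ K) → q x = 0 → x = 0}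
    (by
      intro c hcS hc R hR
      refine ⟨sSup c, ⟨sSup_le fun M hM => (hcS hM).1, fun x hx hqx => ?_⟩, fun M hM => le_sSup hM⟩
      have : ∀ t : Finset (Fin (finrank F V)), ∃ M ∈ c, ∀ i ∈ t, x i ∈ M := by
        intro t
        induction t using Finset.induction_on with
        | empty => exact ⟨R, hR, by simp⟩
        | insert i t _ ih =>
          obtain ⟨M, hM, h⟩ := ih
          obtain ⟨M', hM', h'⟩ := IntermediateField.exists_mem_of_isChain_sSup hc ⟨R, hR⟩ (hx i)
          rcases hc.total hM hM' with hle | hle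
          · exact ⟨M', hM', by simpa [h'] using fun j hj => hle (h j hj)⟩
          · exact ⟨M, hM, by simpa [hle h'] using h⟩
      obtain ⟨M, hM, h⟩ := this Finset.univ
      exact (hcS hM).2 x (fun i => h i (Finset.mem_univ i)) hqx)
    ⊥ ⟨bot_le, (hiff ⊥).1 hbot⟩
  have hKpy := hK.1.1
  have hKan := (hiff K).2 hK.1.2
  have hpos := isHereditarilyTotallyPositive_of_le_pythagoreanClosure hKpy
  have hKreal : IsSemireal K := by
    obtain ⟨P, hP⟩ := exists_isOrdering F
    obtain ⟨Q, -, -⟩ := hpos ⊥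
      (P.comap (IntermediateField.botEquiv F K : _ →+* F)) (hP.comap _)
    exact Q.isSemireal
  refine ⟨K, hKpy, hpos, ?_, hKreal, fun hpy => htor.not_anisotropic_formExt K hpy hKan, hKan, ?_⟩
  · refine ⟨IntermediateField.inclusion (hKpy.trans ?_)⟩
    -- A field in which every element is a square is pythagorean, so the pythagorean closure lies in
    -- the quadratic closure.
    exact sInf_le_sInf fun L hL x _ => hL x
  intro L _ _ _ _ hne hL h2 hLan
  rw [formExt_anisotropic_iff b φ hb] at hLan
  obtain ⟨a, s, hs, hsK⟩ := exists_sqrt_of_isTwoExtension h2 hne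
  have ha := hL.isSumSq hs
  obtain ⟨r, hr⟩ := IsAlgClosed.exists_eq_mul_self (a : Ω)
  have hrK : r ∉ K := by
    intro hrK
    have h1 : s * s = algebraMap K L ⟨r, hrK⟩ * algebraMap K L ⟨r, hrK⟩ := by
      rw [hs, ← map_mul]
      exact congrArg _ (Subtype.ext hr)
    rcases mul_self_eq_mul_self_iff.1 h1 with h | h
    · exact hsK ⟨_, h.symm⟩
    · exact hsK ⟨-⟨r, hrK⟩, by rw [map_neg, h]⟩
  have hrr : r * r ∈ K := hr ▸ a.2
  have hrpy := exists_mem_pythagoreanClosure_of_isSumSq hKpy ha hr.symm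
  -- Maximality is contradicted by showing that `K(r)` is admissible: a zero of `q` over `K(r)` is
  -- carried to `L` by replacing `r` with `s`, and anisotropy over `L` kills it.
  refine hrK (hK.2 ⟨?_, fun z hz hqz => ?_⟩ (K.le_adjoinSqrt r hrr) (K.sqrt_mem_adjoinSqrt r hrr))
  · rintro _ ⟨x, hx, y, hy, rfl⟩
    exact add_mem (hKpy hx) (mul_mem (hKpy hy) hrpy)
  choose x hx y hy hxy using hz
  let X : Fin (finrank F V) → K := fun i => ⟨x i, hx i⟩
  let Y : Fin (finrank F V) → K := fun i => ⟨y i, hy i⟩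
  let A : K := ∑ i, algebraMap F K (φ (b i)) * (X i * X i + a * (Y i * Y i))
  let B : K := ∑ i, algebraMap F K (φ (b i)) * (2 * (X i * Y i))
  have hAB : (A : Ω) + B * r = 0 := by
    rw [← hqz]
    refine (map_sum_add_map_sum_mul_sqrt (algebraMap K Ω) _ X Y hr.symm).trans ?_
    refine Finset.sum_congr rfl fun i _ => ?_
    rw [hxy]
    rfl
  obtain ⟨hA, hB⟩ := IntermediateField.eq_zero_of_add_mul_eq_zero hrK A.2 B.2 hAB
  have hA : A = 0 := Subtype.ext hA
  have hB : B = 0 := Subtype.ext hB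
  have hz0 := hLan (fun i => algebraMap K L (X i) + algebraMap K L (Y i) * s) (by
    have : algebraMap K L A + algebraMap K L B * s = 0 := by rw [hA, hB]; simp
    rw [← this, map_sum_add_map_sum_mul_sqrt (algebraMap K L) _ X Y hs]
    simp only [← IsScalarTower.algebraMap_apply])
  have hsbot : s ∉ (⊥ : IntermediateField K L) := hsK
  funext i
  obtain ⟨h1, h2⟩ := IntermediateField.eq_zero_of_add_mul_eq_zero hsbot
    (IntermediateField.algebraMap_mem _ _) (IntermediateField.algebraMap_mem _ _) (congrFun hz0 i)
  have h1 : x i = 0 := congrArg Subtype.val ((map_eq_zero (algebraMap K L)).1 h1)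
  have h2 : y i = 0 := congrArg Subtype.val ((map_eq_zero (algebraMap K L)).1 h2)
  rw [hxy, h1, h2, zero_mul, add_zero, Pi.zero_apply]
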